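/- All graphs are finite and simple. For a graph $G$, let $\mathcal{S}(G)$ be the set of real symmetric matrices $A$, with rows and columns indexed by $V(G)$, such that for all distinct $a,b\in V(G)$ the entry $A_{a,b}$ is nonzero if and only if $\{a,b\}$ is an edge of $G$ (the diagonal entries are arbitrary). For $i\in V(G)$, let $A(i)$ be the matrix obtained from $A$ by deleting row $i$ and column $i$. The matrix $A$ has the $i$-strong nullity interlacing property ($i$-SNIP) if $X=O$ is the only real symmetric matrix $X$ such that $A\circ X=O$, $I\circ X=O$ (entrywise products), and all rows of $AX$ except possibly row $i$ are zero. Define $$\xi\xi(G,i)=\max\{\operatorname{null}(A)+\operatorname{null}(A(i)) : A\in\mathcal{S}(G),\ A\text{ has }i\text{-SNIP},\ \operatorname{null}(A)\le\operatorname{null}(A(i))\}.$$ If $v$ is a vertex label occurring in both of two otherwise vertex-disjoint graphs $G$ and $H$, then the vertex sum $G\oplus_v H$ is the graph obtained from them by identifying the two vertices labeled $v$, all other vertices remaining distinct. **Theorem.** Let $G_0,G_1,G_2$ be graphs, let $v_1,v_2\in V(G_0)$ (possibly $v_1=v_2$) be labels of a vertex of $G_1$ and of a vertex of $G_2$, respectively,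 and let $G=G_1\oplus_{v_1}G_0\oplus_{v_2}G_2$, where $G_1$ and $G_2$ are connected graphs on at least $2$ vertices. Let $i\in V(G_0)$. Then $$\xi\xi(G,i)=\max\{\xi\xi(K_2\oplus_{v_1}G_0\oplus_{v_2}G_2,\,i),\ \xi\xi(G_1\oplus_{v_1}G_0\oplus_{v_2}K_2,\,i)\},$$ where in each vertex sum with the complete graph $K_2$ one of the two vertices of $K_2$ carries the label $v_1$ or $v_2$, respectively. -/

import Mathlib

namespace RootedGraph

/-- `𝒮(G)`: the real symmetric matrices indexed by the vertices of `G` whose off-diagonal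
`(a, b)`-entry is nonzero if and only if `a` and `b` are adjacent; the diagonal is arbitrary. -/
def matricesOf {V : Type*} (G : SimpleGraph V) : Set (Matrix V V ℝ) :=
  {A | A.IsSymm ∧ ∀ a b, a ≠ b → (A a b ≠ 0 ↔ G.Adj a b)}

/-- The nullity of a square real matrix. -/
noncomputable def nullity {V : Type*} [Fintype V] (A : Matrix V V ℝ) : ℕ :=
  Module.finrank ℝ (LinearMap.ker A.mulVecLin)

/-- `A(i)`: the principal submatrix obtained by removing row `i` and column `i`. -/
def deleteIndex {V : Type*} (A : Matrix V V ℝ) (i : V) : Matrix {j // j ≠ i} {j // j ≠ i} ℝ :=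
  A.submatrix Subtype.val Subtype.val

/-- `M(i,:]`: the matrix obtained by removing row `i` and keeping all columns. -/
def deleteRow {V : Type*} (M : Matrix V V ℝ) (i : V) : Matrix {j // j ≠ i} V ℝ :=
  M.submatrix Subtype.val id

/-- The `i`-strong nullity interlacing property (`i`-SNIP). -/
def HasSNIP {V : Type*} [Fintype V] [DecidableEq V] (A : Matrix V V ℝ) (i : V) : Prop :=
  ∀ X : Matrix V V ℝ, X.IsSymm → Matrix.hadamard A X = 0 →
    Matrix.hadamard (1 : Matrix V V ℝ) X = 0 → deleteRow (A * X) i = 0 → X = 0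

/-- `(G, i)` allows the nullity pair `(k, l)` with `i`-SNIP. -/
def AllowsWithSNIP {V : Type*} [Fintype V] [DecidableEq V] (G : SimpleGraph V) (i : V)
    (k l : ℕ) : Prop :=
  ∃ A ∈ matricesOf G, nullity A = k ∧ nullity (deleteIndex A i) = l ∧ HasSNIP A i

/-- The set of sums `k + l` over the nullity pairs `(k, l)` with `k ≤ l` which `(G, i)` allows
with `i`-SNIP. -/
def nullitySums {V : Type*} [Fintype V] [DecidableEq V] (G : SimpleGraph V) (i : V) : Set ℕ :=
  {s | ∃ k l, k ≤ l ∧ AllowsWithSNIP G i k l ∧ s = k + l}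

/-- The parameter `ξξ(G, i)`: the largest element of `nullitySums G i`
(see `isGreatest_xixi` for the existence of this maximum). -/
noncomputable def xixi {V : Type*} [Fintype V] [DecidableEq V] (G : SimpleGraph V) (i : V) : ℕ :=
  sSup (nullitySums G i)

theorem nullity_le_card {V : Type*} [Fintype V] (A : Matrix V V ℝ) :
    nullity A ≤ Fintype.card V := by
  have h := Submodule.finrank_le (LinearMap.ker A.mulVecLin)
  rwa [Module.finrank_fintype_fun_eq_card] at h

theorem nullity_eq_zero_of_det_ne_zero {V : Type*} [Fintype V] [DecidableEq V]
    {A : Matrix V V ℝ} (h : A.det ≠ 0) : nullity A = 0 := by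
  have hk : LinearMap.ker A.mulVecLin = ⊥ := by
    rw [LinearMap.ker_eq_bot']
    intro x hx
    exact Matrix.eq_zero_of_mulVec_eq_zero h hx
  rw [nullity, hk, finrank_bot]

theorem zero_mem_nullitySums {V : Type*} [Fintype V] [DecidableEq V] (G : SimpleGraph V)
    (i : V) : 0 ∈ nullitySums G i := by
  classical
  set c : ℝ := (Fintype.card V : ℝ) + 1 with hc
  set A : Matrix V V ℝ := Matrix.of fun a b => if a = b then c else if G.Adj a b then 1 else 0
    with hA
  have hdiag : ∀ a, A a a = c := fun a => by simp [hA]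
  have hoff : ∀ a b, a ≠ b → A a b = if G.Adj a b then 1 else 0 := fun a b hab => by
    simp [hA, hab]
  have hc0 : 0 < c := by positivity
  have hle : ∀ a b, a ≠ b → ‖A a b‖ ≤ 1 := fun a b hab => by
    rw [hoff a b hab]; split_ifs <;> simp
  have hsymm : A.IsSymm := by
    ext a b
    by_cases hab : a = b
    · subst hab; rfl
    · rw [Matrix.transpose_apply, hoff a b hab, hoff b a (Ne.symm hab)]
      simp [G.adj_comm]
  have hdet : A.det ≠ 0 := by
    apply det_ne_zero_of_sum_row_lt_diag
    intro a
    rw [hdiag, Real.norm_of_nonneg hc0.le]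
    calc ∑ b ∈ Finset.univ.erase a, ‖A a b‖ ≤ ∑ b ∈ Finset.univ.erase a, (1 : ℝ) :=
          Finset.sum_le_sum fun b hb => hle a b (Finset.ne_of_mem_erase hb).symm
      _ ≤ (Fintype.card V : ℝ) := by
          rw [Finset.sum_const, nsmul_eq_mul, mul_one]
          exact_mod_cast Finset.card_le_univ _
      _ < c := by simp [hc]
  have hdet' : (deleteIndex A i).det ≠ 0 := by
    apply det_ne_zero_of_sum_row_lt_diag
    intro a
    have h1 : deleteIndex A i a a = c := hdiag a
    rw [h1, Real.norm_of_nonneg hc0.le]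
    calc ∑ b ∈ Finset.univ.erase a, ‖deleteIndex A i a b‖
          ≤ ∑ b ∈ Finset.univ.erase a, (1 : ℝ) :=
          Finset.sum_le_sum fun b hb =>
            hle a b fun h => Finset.ne_of_mem_erase hb (Subtype.ext h.symm)
      _ ≤ (Fintype.card {j // j ≠ i} : ℝ) := by
          rw [Finset.sum_const, nsmul_eq_mul, mul_one]
          exact_mod_cast Finset.card_le_univ _
      _ ≤ (Fintype.card V : ℝ) := by exact_mod_cast Fintype.card_subtype_le _
      _ < c := by simp [hc]
  refine ⟨0, 0, le_rfl, ⟨A, ⟨hsymm, fun a b hab => ?_⟩, nullity_eq_zero_of_det_ne_zero hdet,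
    nullity_eq_zero_of_det_ne_zero hdet', ?_⟩, rfl⟩
  · rw [hoff a b hab]; simp
  · intro X hX _ hI hrow
    have hXd : ∀ a, X a a = 0 := fun a => by
      have := congrFun (congrFun hI a) a
      simpa using this
    have hAX : ∀ a, a ≠ i → ∀ b, ∑ j, A a j * X j b = 0 := fun a ha b => by
      have := congrFun (congrFun hrow ⟨a, ha⟩) b
      simpa [deleteRow, Matrix.mul_apply] using this
    have hcol : ∀ b, X i b = 0 → ∀ a, X a b = 0 := by
      intro b hib
      have hv : (fun j : {j // j ≠ i} => X j b) = 0 := by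
        apply Matrix.eq_zero_of_mulVec_eq_zero hdet'
        ext a
        have h := hAX a a.2 b
        rw [Fintype.sum_eq_add_sum_subtype_ne _ i, hib, mul_zero, zero_add] at h
        simpa [Matrix.mulVec, dotProduct, deleteIndex] using h
      intro a
      by_cases ha : a = i
      · rw [ha, hib]
      · exact congrFun hv ⟨a, ha⟩
    have hi : ∀ b, X i b = 0 := fun b => by
      rw [← hX.apply]; exact hcol i (hXd i) b
    ext a b
    exact hcol b (hi b) a

/-- The maximum in the definition of `ξξ(G, i)` exists. -/
theorem isGreatest_xixi {V : Type*} [Fintype V] [DecidableEq V] (G : SimpleGraph V) (i : V) :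
    IsGreatest (nullitySums G i) (xixi G i) := by
  have hb : BddAbove (nullitySums G i) := by
    refine ⟨Fintype.card V + Fintype.card {j // j ≠ i}, ?_⟩
    rintro s ⟨k, l, -, ⟨A, -, rfl, rfl, -⟩, rfl⟩
    exact add_le_add (nullity_le_card _) (nullity_le_card _)
  exact ⟨Nat.sSup_mem ⟨0, zero_mem_nullitySums G i⟩ hb, fun s hs => le_csSup hb hs⟩

/-- The vertex sum of `G` and `H`, identifying the vertex `v` of `G` with the vertex `w` of `H`.
The vertices of `G` are kept, as `Sum.inl`; those of `H` other than `w` are added, as `Sum.inr`;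
the identified vertex is `Sum.inl v`. -/
def vertexSum {V W : Type*} (G : SimpleGraph V) (v : V) (H : SimpleGraph W) (w : W) :
    SimpleGraph (V ⊕ {x : W // x ≠ w}) where
  Adj
    | Sum.inl a, Sum.inl b => G.Adj a b
    | Sum.inl a, Sum.inr y => a = v ∧ H.Adj w y
    | Sum.inr x, Sum.inl b => b = v ∧ H.Adj x w
    | Sum.inr x, Sum.inr y => H.Adj x y
  symm := ⟨by
    rintro (a | x) (b | y) h
    · exact SimpleGraph.Adj.symm (G := G) h
    · exact ⟨h.1, SimpleGraph.Adj.symm (G := H) h.2⟩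
    · exact ⟨h.1, SimpleGraph.Adj.symm (G := H) h.2⟩
    · exact SimpleGraph.Adj.symm (G := H) h⟩
  loopless := ⟨by
    rintro (a | x) h
    · exact G.irrefl h
    · exact H.irrefl h⟩

end RootedGraph

namespace RootedGraph

open Matrix

/-! ### Null vectors and the SNIP -/

section General

variable {V : Type*} [Fintype V]

/-! A piece pendant at `v` interacts with a null vector only through the equations `B z + s b = 0`
of its own rows, where `s` is the value at `v`, and through the term `b ⬝ᵥ z` that it adds to row
`v`. If no nonzero null vector lives inside the piece, the solutions are the `(t u, s)` with `c t +
s = 0`, so the rest of the graph sees only `c` and `β = b ⬝ᵥ u`. Changing the diagonal entry at `v`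
shifts `β` by any multiple of `c`, so `β` matters only when `c = 0`. Every piece in which `v` has a
neighbour, `K₂` included, realizes every `c`, with any prescribed nonzero `β` when `c = 0`. Pieces
with matching parameters can be exchanged without affecting the two nullities or the SNIP
(`Exchange.nullity_eq`, `Exchange.nullity_deleteIndex_eq`, `Exchange.hasSNIP`). Putting `G₁` or `G₂`
in place of `K₂` in this way gives `≥`.

For `≤`, nonzero null vectors `x` and `y` inside the two pieces would make `x yᵀ + y xᵀ` violate the
SNIP (`HasSNIP.eq_zero_or_eq_zero`). Hence one of the pieces contains no nonzero null vector and may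
be exchanged for `K₂`. -/

theorem hasSNIP_iff [DecidableEq V] (A : Matrix V V ℝ) (i : V) :
    HasSNIP A i ↔ ∀ X : Matrix V V ℝ, X.IsSymm → (∀ a b, A a b * X a b = 0) →
      (∀ a, X a a = 0) → (∀ a, a ≠ i → ∀ b, (A *ᵥ fun r => X r b) a = 0) → X = 0 := by
  refine forall_congr' fun X => forall_congr' fun _ => ?_
  have h1 : Matrix.hadamard A X = 0 ↔ ∀ a b, A a b * X a b = 0 := by
    simp [← Matrix.ext_iff]
  have h2 : Matrix.hadamard (1 : Matrix V V ℝ) X = 0 ↔ ∀ a, X a a = 0 := by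
    simp only [← Matrix.ext_iff, Matrix.hadamard_apply, Matrix.zero_apply, Matrix.one_apply]
    refine ⟨fun h a => by simpa using h a a, fun h a b => ?_⟩
    split_ifs with hab
    · rw [← hab, h, mul_zero]
    · rw [zero_mul]
  have h3 : deleteRow (A * X) i = 0 ↔ ∀ a, a ≠ i → ∀ b, (A *ᵥ fun r => X r b) a = 0 := by
    simp [← Matrix.ext_iff, deleteRow, Matrix.mul_apply, Matrix.mulVec, dotProduct]
  rw [h1, h2, h3]

/-- The vectors vanishing on `J` whose image under `A` vanishes off `J`: the kernel of the
principal submatrix obtained by removing the rows and columns in `J`, extended by zero. -/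
def rowKernel (A : Matrix V V ℝ) (J : Set V) : Submodule ℝ (V → ℝ) where
  carrier := {z | (∀ j ∉ J, (A *ᵥ z) j = 0) ∧ ∀ j ∈ J, z j = 0}
  add_mem' := by
    rintro y z ⟨h1, h2⟩ ⟨h3, h4⟩
    refine ⟨fun j hj => ?_, fun j hj => ?_⟩
    · rw [Matrix.mulVec_add, Pi.add_apply, h1 j hj, h3 j hj, add_zero]
    · rw [Pi.add_apply, h2 j hj, h4 j hj, add_zero]
  zero_mem' := by simp
  smul_mem' := by
    rintro c z ⟨h1, h2⟩
    refine ⟨fun j hj => ?_, fun j hj => ?_⟩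
    · rw [Matrix.mulVec_smul, Pi.smul_apply, h1 j hj, smul_zero]
    · rw [Pi.smul_apply, h2 j hj, smul_zero]

theorem mem_rowKernel {A : Matrix V V ℝ} {J : Set V} {z : V → ℝ} :
    z ∈ rowKernel A J ↔ (∀ j ∉ J, (A *ᵥ z) j = 0) ∧ ∀ j ∈ J, z j = 0 := Iff.rfl

theorem nullity_eq_finrank_rowKernel (A : Matrix V V ℝ) :
    nullity A = Module.finrank ℝ (rowKernel A ∅) := by
  have h : LinearMap.ker A.mulVecLin = rowKernel A ∅ := by
    ext z
    simp [mem_rowKernel, funext_iff]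
  rw [nullity, h]

/-- Both nullities thus become dimensions of spaces `rowKernel A J`, with `J = ∅` and `J = {i}`, and
one argument serves for both. -/
theorem nullity_deleteIndex_eq_finrank_rowKernel [DecidableEq V] (A : Matrix V V ℝ) (i : V) :
    nullity (deleteIndex A i) = Module.finrank ℝ (rowKernel A {i}) := by
  have key : ∀ z : V → ℝ, z i = 0 → ∀ a : {j // j ≠ i},
      (deleteIndex A i *ᵥ fun j => z j) a = (A *ᵥ z) a := by
    intro z hz a
    simp only [Matrix.mulVec, dotProduct]
    rw [Fintype.sum_eq_add_sum_subtype_ne _ i, hz, mul_zero, zero_add]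
    rfl
  let f : rowKernel A {i} →ₗ[ℝ] ({j // j ≠ i} → ℝ) :=
    (LinearMap.funLeft ℝ ℝ Subtype.val).comp (rowKernel A {i}).subtype
  have hf : Function.Injective f := by
    rw [← LinearMap.ker_eq_bot, LinearMap.ker_eq_bot']
    rintro ⟨z, hz⟩ h0
    ext a
    by_cases ha : a = i
    · subst ha; exact hz.2 a rfl
    · exact congrFun h0 ⟨a, ha⟩
  have hr : LinearMap.range f = LinearMap.ker (deleteIndex A i).mulVecLin := by
    ext y
    rw [LinearMap.mem_range, LinearMap.mem_ker, Matrix.mulVecLin_apply]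
    constructor
    · rintro ⟨⟨z, hz⟩, rfl⟩
      ext a
      exact (key z (hz.2 i rfl) a).trans (hz.1 a a.2)
    · intro hy
      let z : V → ℝ := fun j => if h : j = i then 0 else y ⟨j, h⟩
      have hzi : z i = 0 := by simp [z]
      have hzy : (fun j : {j // j ≠ i} => z j) = y := by
        ext ⟨j, hj⟩
        simp [z, hj]
      refine ⟨⟨z, fun j hj => ?_, fun j hj => ?_⟩, hzy⟩
      · rw [← key z hzi ⟨j, hj⟩, hzy, hy]; rfl
      · rw [Set.mem_singleton_iff.1 hj, hzi]
  rw [nullity, ← hr, LinearMap.finrank_range_of_inj hf]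

/-- Two null vectors whose supports are not joined by nonzero entries violate the `i`-SNIP. -/
theorem HasSNIP.eq_zero_or_eq_zero [DecidableEq V] {A : Matrix V V ℝ} {i : V} (hA : HasSNIP A i)
    (hsymm : A.IsSymm) {x y : V → ℝ} (hx : A *ᵥ x = 0) (hy : A *ᵥ y = 0)
    (hxy : ∀ a b, x a ≠ 0 → y b ≠ 0 → a ≠ b ∧ A a b = 0) : x = 0 ∨ y = 0 := by
  have hdisj : ∀ a b, (a = b ∨ A a b ≠ 0) → x a * y b = 0 := by
    intro a b h
    by_contra hne
    obtain ⟨h1, h2⟩ := hxy a b (left_ne_zero_of_mul hne) (right_ne_zero_of_mul hne)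
    exact h.elim h1 fun h => h h2
  -- Every column of `x yᵀ + y xᵀ` is a combination of `x` and `y`, so `A` annihilates it; the
  -- support hypothesis clears the diagonal and the edge positions.
  have hX := (hasSNIP_iff A i).1 hA (vecMulVec x y + vecMulVec y x) ?_ ?_ ?_ ?_
  · by_contra! hne
    obtain ⟨a, ha⟩ := Function.ne_iff.1 hne.1
    obtain ⟨b, hb⟩ := Function.ne_iff.1 hne.2
    have hya : y a = 0 := (mul_eq_zero.1 (hdisj a a (Or.inl rfl))).resolve_left ha
    have := congrFun (congrFun hX a) b
    simp only [Matrix.add_apply, vecMulVec_apply, hya, zero_mul, add_zero, Matrix.zero_apply]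
      at this
    exact mul_ne_zero ha hb this
  · rw [Matrix.IsSymm, transpose_add, transpose_vecMulVec, transpose_vecMulVec, add_comm]
  · intro a b
    by_cases h : A a b = 0
    · rw [h, zero_mul]
    · have h' : A b a ≠ 0 := by rwa [hsymm.apply]
      rw [Matrix.add_apply, vecMulVec_apply, vecMulVec_apply, hdisj a b (Or.inr h), mul_comm (y a),
        hdisj b a (Or.inr h'), add_zero, mul_zero]
  · intro a
    rw [Matrix.add_apply, vecMulVec_apply, vecMulVec_apply, mul_comm (y a),
      hdisj a a (Or.inl rfl), add_zero]
  · intro a _ b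
    have : (fun r => (vecMulVec x y + vecMulVec y x) r b) = y b • x + x b • y := by
      ext r
      simp [vecMulVec_apply, mul_comm]
    rw [this, mulVec_add, mulVec_smul, mulVec_smul, hx, hy]
    simp

end General

/-! ### Invariance under isomorphism -/

section Iso

variable {V W : Type*} [Fintype V] [Fintype W]

theorem finrank_rowKernel_submatrix (A : Matrix V V ℝ) (e : W ≃ V) (J : Set V) :
    Module.finrank ℝ (rowKernel (A.submatrix e e) (e ⁻¹' J)) =
      Module.finrank ℝ (rowKernel A J) := by
  have h : rowKernel (A.submatrix e e) (e ⁻¹' J) =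
      (rowKernel A J).map (LinearEquiv.funCongrLeft ℝ ℝ e : (V → ℝ) →ₗ[ℝ] (W → ℝ)) := by
    ext z
    rw [Submodule.mem_map_equiv, mem_rowKernel, mem_rowKernel]
    have hz : ((LinearEquiv.funCongrLeft ℝ ℝ e).symm z) = z ∘ e.symm := rfl
    rw [hz, Matrix.submatrix_mulVec_equiv]
    constructor
    · rintro ⟨h1, h2⟩
      exact ⟨fun j hj => by simpa using h1 (e.symm j) (by simpa using hj),
        fun j hj => h2 (e.symm j) (by simpa using hj)⟩
    · rintro ⟨h1, h2⟩
      exact ⟨fun j hj => h1 (e j) hj, fun j hj => by simpa using h2 (e j) hj⟩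
  rw [h]
  exact LinearEquiv.finrank_map_eq _ _

theorem nullity_submatrix (A : Matrix V V ℝ) (e : W ≃ V) :
    nullity (A.submatrix e e) = nullity A := by
  rw [nullity_eq_finrank_rowKernel, nullity_eq_finrank_rowKernel,
    ← finrank_rowKernel_submatrix A e, Set.preimage_empty]

theorem nullity_deleteIndex_submatrix [DecidableEq V] [DecidableEq W] (A : Matrix V V ℝ)
    (e : W ≃ V) (i : W) :
    nullity (deleteIndex (A.submatrix e e) i) = nullity (deleteIndex A (e i)) := by
  have h : (e : W → V) ⁻¹' {e i} = {i} := by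
    ext a
    exact e.injective.eq_iff
  rw [nullity_deleteIndex_eq_finrank_rowKernel, nullity_deleteIndex_eq_finrank_rowKernel,
    ← finrank_rowKernel_submatrix A e, h]

theorem HasSNIP.submatrix [DecidableEq V] [DecidableEq W] {A : Matrix V V ℝ} {i : V} (hA : HasSNIP A i) (e : W ≃ V) :
    HasSNIP (A.submatrix e e) (e.symm i) := by
  rw [hasSNIP_iff] at hA ⊢
  intro X h1 h2 h3 h4
  have := hA (X.submatrix e.symm e.symm) (h1.submatrix _) (fun a b => by
    simpa using h2 (e.symm a) (e.symm b)) (fun a => h3 _) (fun a ha b => by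
    have := h4 (e.symm a) (by simpa using ha) (e.symm b)
    rw [Matrix.submatrix_mulVec_equiv] at this
    simpa [Function.comp_def] using this)
  ext a b
  simpa using congrFun (congrFun this (e a)) (e b)

theorem AllowsWithSNIP.of_iso [DecidableEq V] [DecidableEq W] {G : SimpleGraph V} {H : SimpleGraph W} (e : H ≃g G) {i : W}
    {k l : ℕ} (h : AllowsWithSNIP G (e i) k l) : AllowsWithSNIP H i k l := by
  obtain ⟨A, hA, rfl, rfl, hs⟩ := h
  refine ⟨A.submatrix e.toEquiv e.toEquiv, ⟨hA.1.submatrix _, fun a b hab => ?_⟩, ?_, ?_, ?_⟩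
  · exact (hA.2 (e a) (e b) (e.injective.ne hab)).trans e.map_rel_iff
  · exact nullity_submatrix A e.toEquiv
  · exact nullity_deleteIndex_submatrix A e.toEquiv i
  · have := hs.submatrix e.toEquiv
    have hi : e.toEquiv.symm (e i) = i := e.toEquiv.symm_apply_apply i
    rwa [hi] at this

end Iso

/-! ### Blocks governed by one parameter -/

section KernelLine

variable {P : Type*} [Fintype P]

/-- The solutions `(z, s)` of `B z + s b = 0` are the `(t u, s)` with `c t + s = 0`. -/
def KernelLine (B : Matrix P P ℝ) (b u : P → ℝ) (c : ℝ) : Prop :=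
  ∀ (z : P → ℝ) (s : ℝ), B *ᵥ z + s • b = 0 ↔ ∃ t : ℝ, z = t • u ∧ c * t + s = 0

/-- The case of `K₂`: with edge weight `β` and diagonal entry `β c` the equation is `β (c z + s) =
0`. -/
theorem kernelLine_of_unique [Unique P] {β : ℝ} (hβ : β ≠ 0) (c : ℝ) :
    KernelLine (Matrix.of fun _ _ : P => β * c) (fun _ => β) (fun _ => 1) c := by
  intro z s
  have h : (Matrix.of fun _ _ : P => β * c) *ᵥ z + s • (fun _ : P => β) =
      fun _ => β * (c * z default + s) := by
    ext p
    simp [Matrix.mulVec, dotProduct]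
    ring
  rw [h]
  constructor
  · intro h0
    refine ⟨z default, ?_, ?_⟩
    · ext p
      simp [Subsingleton.elim p default]
    · exact (mul_eq_zero.1 (congrFun h0 default)).resolve_left hβ
  · rintro ⟨t, rfl, ht⟩
    ext p
    simp [ht]

theorem kernelLine_of_det_ne_zero [DecidableEq P] {B : Matrix P P ℝ} (hB : B.det ≠ 0)
    (b : P → ℝ) {c : ℝ} (hc : c ≠ 0) : KernelLine B b (c • B⁻¹ *ᵥ b) c := by
  have hu : IsUnit B.det := isUnit_iff_ne_zero.2 hB
  have hb : B *ᵥ (B⁻¹ *ᵥ b) = b := by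
    rw [mulVec_mulVec, mul_nonsing_inv _ hu, one_mulVec]
  intro z s
  constructor
  · intro h
    refine ⟨-s / c, ?_, by field_simp; ring⟩
    have h1 : B *ᵥ (z - (-s / c) • c • B⁻¹ *ᵥ b) = 0 := by
      rw [mulVec_sub, mulVec_smul, mulVec_smul, hb, smul_smul, div_mul_cancel₀ _ hc, ← h]
      module
    exact sub_eq_zero.1 (eq_zero_of_mulVec_eq_zero hB h1)
  · rintro ⟨t, rfl, ht⟩
    rw [mulVec_smul, mulVec_smul, hb, eq_neg_of_add_eq_zero_right ht]
    module

theorem kernelLine_of_kernel {B : Matrix P P ℝ} (hB : B.IsSymm) {b x : P → ℝ}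
    (hx : B *ᵥ x = 0) (hbx : b ⬝ᵥ x ≠ 0) (hker : ∀ z, B *ᵥ z = 0 → ∃ t : ℝ, z = t • x)
    {α : ℝ} (hα : α ≠ 0) : KernelLine B b (α • x) 0 := by
  intro z s
  constructor
  · intro h
    -- Pairing the equation with `x` eliminates `B z` and leaves `s (x ⬝ᵥ b) = 0`.
    have h1 : x ⬝ᵥ (B *ᵥ z) = 0 := by
      rw [dotProduct_mulVec, ← mulVec_transpose, hB.eq, hx, zero_dotProduct]
    have h2 := congrArg (x ⬝ᵥ ·) h
    simp only [dotProduct_add, h1, dotProduct_smul, dotProduct_zero, zero_add, smul_eq_mul] at h2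
    have hs : s = 0 := (mul_eq_zero.1 h2).resolve_right (by rwa [dotProduct_comm])
    rw [hs, zero_smul, add_zero] at h
    obtain ⟨t, rfl⟩ := hker z h
    exact ⟨t / α, by rw [smul_smul, div_mul_cancel₀ _ hα], by rw [hs]; ring⟩
  · rintro ⟨t, rfl, ht⟩
    rw [zero_mul, zero_add] at ht
    rw [ht, mulVec_smul, mulVec_smul, hx]
    simp

end KernelLine

/-! ### Exchanging a pendant block -/

section Glue

variable {R P P' : Type*} [DecidableEq R]

/-- The symmetric block matrix with diagonal blocks `M` and `B`, whose off-diagonal blocks have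
`b` in the row (respectively column) of `v` and are zero elsewhere. -/
def glue (M : Matrix R R ℝ) (v : R) (b : P → ℝ) (B : Matrix P P ℝ) : Matrix (R ⊕ P) (R ⊕ P) ℝ :=
  Matrix.fromBlocks M (Matrix.of fun r p => if r = v then b p else 0)
    (Matrix.of fun p r => if r = v then b p else 0) B

theorem glue_isSymm_iff {M : Matrix R R ℝ} {v : R} {b : P → ℝ} {B : Matrix P P ℝ} :
    (glue M v b B).IsSymm ↔ M.IsSymm ∧ B.IsSymm := by
  have h : (Matrix.of fun (p : P) (r : R) => if r = v then b p else 0)ᵀ =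
      Matrix.of fun r p => if r = v then b p else 0 := rfl
  have h' : (Matrix.of fun (r : R) (p : P) => if r = v then b p else 0)ᵀ =
      Matrix.of fun p r => if r = v then b p else 0 := rfl
  rw [glue, isSymm_fromBlocks_iff, h, h']
  tauto

theorem glue_mem_matricesOf {H : SimpleGraph R} {v : R} {W : Type*} {K : SimpleGraph W} {w : W}
    {M : Matrix R R ℝ} {b : {x // x ≠ w} → ℝ} {B : Matrix {x // x ≠ w} {x // x ≠ w} ℝ}
    (hM : M ∈ matricesOf H) (hb : ∀ p, b p ≠ 0 ↔ K.Adj w p)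
    (hB : B ∈ matricesOf (K.comap Subtype.val)) : glue M v b B ∈ matricesOf (vertexSum H v K w) := by
  refine ⟨glue_isSymm_iff.2 ⟨hM.1, hB.1⟩, ?_⟩
  rintro (r | p) (s | q) hne
  · exact hM.2 r s fun h => hne (congrArg _ h)
  · by_cases h : r = v <;> simp [glue, vertexSum, h, hb]
  · by_cases h : s = v <;> simp [glue, vertexSum, h, hb, K.adj_comm]
  · exact hB.2 p q fun h => hne (congrArg _ h)

theorem exists_eq_glue {H : SimpleGraph R} {v : R} {W : Type*} {K : SimpleGraph W} {w : W}
    {A : Matrix (R ⊕ {x // x ≠ w}) (R ⊕ {x // x ≠ w}) ℝ}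
    (hA : A ∈ matricesOf (vertexSum H v K w)) :
    ∃ (M : Matrix R R ℝ) (b : {x // x ≠ w} → ℝ) (B : Matrix {x // x ≠ w} {x // x ≠ w} ℝ),
      M ∈ matricesOf H ∧ (∀ p, b p ≠ 0 ↔ K.Adj w p) ∧ B ∈ matricesOf (K.comap Subtype.val) ∧
        A = glue M v b B := by
  have hrp : ∀ r p, A (Sum.inl r) (Sum.inr p) ≠ 0 ↔ r = v ∧ K.Adj w p := fun r p =>
    hA.2 _ _ Sum.inl_ne_inr
  have hzero : ∀ r p, r ≠ v → A (Sum.inl r) (Sum.inr p) = 0 := fun r p hr => by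
    by_contra h
    exact hr ((hrp r p).1 h).1
  refine ⟨A.toBlocks₁₁, fun p => A (Sum.inl v) (Sum.inr p), A.toBlocks₂₂,
    ⟨hA.1.submatrix _, fun a b hab => hA.2 _ _ (Sum.inl_injective.ne hab)⟩,
    fun p => by simp [hrp], ⟨hA.1.submatrix _, fun a b hab => hA.2 _ _ (Sum.inr_injective.ne hab)⟩,
    ?_⟩
  ext (r | p) (s | q)
  · rfl
  · by_cases h : r = v
    · simp [glue, h]
    · simp [glue, h, hzero]
  · rw [← hA.1.apply]
    by_cases h : s = v
    · simp [glue, h]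
    · simp [glue, h, hzero]
  · rfl

theorem add_single_mem_matricesOf {H : SimpleGraph R} {M : Matrix R R ℝ} (hM : M ∈ matricesOf H)
    (v : R) (d : ℝ) : M + Matrix.single v v d ∈ matricesOf H := by
  refine ⟨hM.1.add (by rw [Matrix.IsSymm, transpose_single]), fun a b hab => ?_⟩
  have : ¬(v = a ∧ v = b) := fun h => hab (h.1.symm.trans h.2)
  rw [Matrix.add_apply, single_apply_of_ne _ _ _ _ _ this, add_zero]
  exact hM.2 a b hab

variable [Fintype P] [Fintype P']

theorem glue_mulVec_inr [Fintype R] (M : Matrix R R ℝ) (v : R) (b : P → ℝ) (B : Matrix P P ℝ)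
    (z : R ⊕ P → ℝ) (p : P) :
    (glue M v b B *ᵥ z) (Sum.inr p) = (B *ᵥ (z ∘ Sum.inr) + z (Sum.inl v) • b) p := by
  simp [glue, mulVec, dotProduct, mul_comm, add_comm]

theorem glue_mulVec_inl [Fintype R] (M : Matrix R R ℝ) (v : R) (b : P → ℝ) (B : Matrix P P ℝ)
    (z : R ⊕ P → ℝ) (r : R) :
    (glue M v b B *ᵥ z) (Sum.inl r) =
      (M *ᵥ (z ∘ Sum.inl)) r + if r = v then b ⬝ᵥ (z ∘ Sum.inr) else 0 := by
  by_cases h : r = v <;> simp [glue, mulVec, dotProduct, h]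

/-- The data making the glued matrices `glue M v b B` and `glue M' v b' B'` equivalent: the blocks
`B` and `B'` act on kernel vectors through one parameter, in the same way. -/
structure Exchange (M M' : Matrix R R ℝ) (v : R) (b u : P → ℝ) (B : Matrix P P ℝ)
    (b' u' : P' → ℝ) (B' : Matrix P' P' ℝ) (c : ℝ) : Prop where
  left : KernelLine B b u c
  right : KernelLine B' b' u' c
  diag : ∃ d : ℝ, M' = M + Matrix.single v v d ∧ b ⬝ᵥ u + d * c = b' ⬝ᵥ u'

variable {M M' : Matrix R R ℝ} {v : R} {b u : P → ℝ} {B : Matrix P P ℝ}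
    {b' u' : P' → ℝ} {B' : Matrix P' P' ℝ} {c : ℝ}

theorem Exchange.symm (h : Exchange M M' v b u B b' u' B' c) :
    Exchange M' M v b' u' B' b u B c := by
  obtain ⟨d, h1, h2⟩ := h.diag
  refine ⟨h.right, h.left, -d, ?_, by linarith⟩
  rw [h1, ← single_neg]
  abel

/-- The vector with values `r` on `R` and `t u` on `P`. -/
def extend (r : R → ℝ) (t : ℝ) (u : P → ℝ) : R ⊕ P → ℝ := Sum.elim r (t • u)

variable [Fintype R]

theorem Exchange.exists_eq_extend (h : Exchange M M' v b u B b' u' B' c) {z : R ⊕ P → ℝ}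
    (hz : ∀ p, (glue M v b B *ᵥ z) (Sum.inr p) = 0) :
    ∃ t, z = extend (z ∘ Sum.inl) t u ∧ c * t + z (Sum.inl v) = 0 := by
  obtain ⟨t, h1, h2⟩ := (h.left (z ∘ Sum.inr) (z (Sum.inl v))).1 (by
    ext p
    rw [← glue_mulVec_inr, hz]
    rfl)
  exact ⟨t, by rw [extend, ← h1, Sum.elim_comp_inl_inr], h2⟩

theorem Exchange.mulVec_extend_inr (h : Exchange M M' v b u B b' u' B' c) {r : R → ℝ} {t : ℝ}
    (ht : c * t + r v = 0) (p : P) : (glue M v b B *ᵥ extend r t u) (Sum.inr p) = 0 := by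
  rw [glue_mulVec_inr]
  exact congrFun ((h.left (t • u) (r v)).2 ⟨t, rfl, ht⟩) p

/-- On solutions the value at `v` is `-c t`, so the extra diagonal entry `d` contributes `-d c t` to
row `v`, exactly offsetting the change from `t (b ⬝ᵥ u)` to `t (b' ⬝ᵥ u')`. -/
theorem Exchange.mulVec_extend_inl (h : Exchange M M' v b u B b' u' B' c) {r : R → ℝ} {t : ℝ}
    (ht : c * t + r v = 0) (a : R) : (glue M' v b' B' *ᵥ extend r t u') (Sum.inl a) =
      (glue M v b B *ᵥ extend r t u) (Sum.inl a) := by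
  obtain ⟨d, h1, h2⟩ := h.diag
  have e1 : extend r t u ∘ Sum.inr = t • u := rfl
  have e2 : extend r t u' ∘ Sum.inr = t • u' := rfl
  have e3 : extend r t u ∘ Sum.inl = r := rfl
  have e4 : extend r t u' ∘ Sum.inl = r := rfl
  rw [glue_mulVec_inl, glue_mulVec_inl, e1, e2, e3, e4, h1, add_mulVec, single_mulVec_eq,
    dotProduct_smul, dotProduct_smul, ← h2, eq_neg_of_add_eq_zero_right ht]
  by_cases hav : a = v
  · subst hav
    simp
    ring
  · simp [hav]

theorem Exchange.finrank_le (h : Exchange M M' v b u B b' u' B' c) (hu : u ≠ 0) (hu' : u' ≠ 0)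
    (J : Set R) : Module.finrank ℝ (rowKernel (glue M v b B) (Sum.inl '' J)) ≤
      Module.finrank ℝ (rowKernel (glue M' v b' B') (Sum.inl '' J)) := by
  obtain ⟨p₀, hp₀⟩ := Function.ne_iff.1 hu
  obtain ⟨p₁, hp₁⟩ := Function.ne_iff.1 hu'
  -- The parameter `t` is read off at a coordinate where `u` is nonzero, which makes the exchange of
  -- `u` for `u'` linear.
  let F : (R ⊕ P → ℝ) →ₗ[ℝ] (R ⊕ P' → ℝ) :=
    { toFun := fun z => extend (z ∘ Sum.inl) (z (Sum.inr p₀) / u p₀) u'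
      map_add' := fun y z => by
        ext (a | p)
        · rfl
        · simp [extend]; ring
      map_smul' := fun k z => by
        ext (a | p)
        · rfl
        · simp [extend]; ring }
  have hF : ∀ (r : R → ℝ) (t : ℝ), F (extend r t u) = extend r t u' := fun r t => by
    have : (t • u) p₀ / u p₀ = t := mul_div_cancel_right₀ t hp₀
    change extend r ((t • u) p₀ / u p₀) u' = _
    rw [this]
  have hform : ∀ z ∈ rowKernel (glue M v b B) (Sum.inl '' J),
      ∃ t, z = extend (z ∘ Sum.inl) t u ∧ c * t + z (Sum.inl v) = 0 := fun z hz =>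
    h.exists_eq_extend fun p => hz.1 _ (by simp)
  have hmaps : ∀ z ∈ rowKernel (glue M v b B) (Sum.inl '' J),
      F z ∈ rowKernel (glue M' v b' B') (Sum.inl '' J) := by
    intro z hz
    obtain ⟨t, h1, h2⟩ := hform z hz
    rw [h1, hF]
    refine ⟨?_, ?_⟩
    · rintro (a | p) hj
      · rw [h.mulVec_extend_inl h2, ← h1]
        exact hz.1 _ fun hj' => hj (by simpa using hj')
      · exact h.symm.mulVec_extend_inr h2 p
    · rintro _ ⟨a, ha, rfl⟩
      exact hz.2 _ ⟨a, ha, rfl⟩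
  refine LinearMap.finrank_le_finrank_of_injective (f := F.restrict hmaps) ?_
  rw [← LinearMap.ker_eq_bot, LinearMap.ker_eq_bot']
  rintro ⟨z, hz⟩ h0
  obtain ⟨t, h1, h2⟩ := hform z hz
  have h3 : F z = 0 := congrArg Subtype.val h0
  rw [h1, hF] at h3
  have h4 : z ∘ Sum.inl = 0 := funext fun a => congrFun h3 (Sum.inl a)
  have h5 : t = 0 := (mul_eq_zero.1 (congrFun h3 (Sum.inr p₁))).resolve_right hp₁
  refine Subtype.ext ?_
  change z = 0
  rw [h1, h4, h5]
  ext (a | p) <;> simp [extend]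

theorem Exchange.nullity_eq (h : Exchange M M' v b u B b' u' B' c) (hu : u ≠ 0) (hu' : u' ≠ 0) :
    nullity (glue M' v b' B') = nullity (glue M v b B) := by
  have h1 := h.finrank_le hu hu' ∅
  have h2 := h.symm.finrank_le hu' hu ∅
  rw [Set.image_empty, Set.image_empty] at h1 h2
  rw [nullity_eq_finrank_rowKernel, nullity_eq_finrank_rowKernel]
  exact le_antisymm h2 h1

variable [DecidableEq P] [DecidableEq P']

theorem Exchange.nullity_deleteIndex_eq (h : Exchange M M' v b u B b' u' B' c) (hu : u ≠ 0)
    (hu' : u' ≠ 0) (i : R) : nullity (deleteIndex (glue M' v b' B') (Sum.inl i)) =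
      nullity (deleteIndex (glue M v b B) (Sum.inl i)) := by
  have h1 := h.finrank_le hu hu' {i}
  have h2 := h.symm.finrank_le hu' hu {i}
  rw [Set.image_singleton, Set.image_singleton] at h1 h2
  rw [nullity_deleteIndex_eq_finrank_rowKernel, nullity_deleteIndex_eq_finrank_rowKernel]
  exact le_antisymm h2 h1

/-- As `i` lies in `R`, every column of a test matrix `X` satisfies the equations of the block, so
its part there is a multiple of `u'`. Replacing `u'` by `u` yields a test matrix for the original
glued matrix. -/
theorem Exchange.hasSNIP (h : Exchange M M' v b u B b' u' B' c) (hu : u ≠ 0)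
    {p₁ : P'} (hp₁ : u' p₁ ≠ 0) (hb₁ : b' p₁ ≠ 0) {i : R}
    (hS : HasSNIP (glue M v b B) (Sum.inl i)) : HasSNIP (glue M' v b' B') (Sum.inl i) := by
  rw [hasSNIP_iff] at hS ⊢
  intro X hsymm hA hI hrow
  have hform : ∀ y, ∃ t, (fun a => X a y) = extend (fun a => X (Sum.inl a) y) t u' ∧
      c * t + X (Sum.inl v) y = 0 := fun y =>
    h.symm.exists_eq_extend fun p => hrow _ Sum.inr_ne_inl y
  choose T hT hTv using hform
  have hXp : ∀ p y, X (Sum.inr p) y = T y * u' p := fun p y => congrFun (hT y) (Sum.inr p)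
  have hXr : ∀ y p, X y (Sum.inr p) = T y * u' p := fun y p => by rw [← hsymm.apply, hXp]
  -- The position `(p₁, v)` carries the nonzero entry `b' p₁`, so `X` vanishes there.
  have hTv0 : T (Sum.inl v) = 0 := by
    have h1 := hA (Sum.inr p₁) (Sum.inl v)
    have h2 : glue M' v b' B' (Sum.inr p₁) (Sum.inl v) = b' p₁ := by simp [glue]
    rw [h2, hXp] at h1
    exact (mul_eq_zero.1 ((mul_eq_zero.1 h1).resolve_left hb₁)).resolve_right hp₁
  -- The zero diagonal entry at `p₁` gives `T = 0` at `p₁`; by symmetry the whole row of `p₁` within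
  -- the block vanishes, hence `T` does on the block.
  have hTp : ∀ p, T (Sum.inr p) = 0 := fun p => by
    have h1 := hI (Sum.inr p₁)
    rw [hXp] at h1
    have h2 := (mul_eq_zero.1 h1).resolve_right hp₁
    have h3 : X (Sum.inr p₁) (Sum.inr p) = 0 := by rw [hXr, h2, zero_mul]
    rw [hXp] at h3
    exact (mul_eq_zero.1 h3).resolve_right hp₁
  have hPP : ∀ p q, X (Sum.inr p) (Sum.inr q) = 0 := fun p q => by rw [hXp, hTp, zero_mul]
  obtain ⟨d, hd, -⟩ := h.diag
  let Y : Matrix (R ⊕ P) (R ⊕ P) ℝ := Matrix.fromBlocks X.toBlocks₁₁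
    (Matrix.of fun r p => T (Sum.inl r) * u p) (Matrix.of fun p r => T (Sum.inl r) * u p) 0
  have hcol : ∀ y, ∃ (k : ℝ) (x : R ⊕ P'), (fun r => Y r y) =
      k • extend (fun a => X (Sum.inl a) x) (T x) u := by
    rintro (s | q)
    · refine ⟨1, Sum.inl s, ?_⟩
      rw [one_smul]
      ext (r | p) <;> rfl
    -- On `R`, column `q` of `Y` and column `p₁` of `X` are `T` scaled by `u q` and by `u' p₁`.
    · refine ⟨u q / u' p₁, Sum.inr p₁, ?_⟩
      ext (r | p)
      · simp only [Y, extend, fromBlocks_apply₁₂, of_apply, Pi.smul_apply, Sum.elim_inl, hXr,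
          smul_eq_mul]
        field_simp
      · simp [Y, extend, hTp]
  have hY : Y = 0 := by
    refine hS Y ?_ ?_ ?_ ?_
    · refine IsSymm.fromBlocks ?_ rfl (Matrix.transpose_zero)
      exact hsymm.submatrix _
    · rintro (r | p) (s | q)
      · have h1 := hA (Sum.inl r) (Sum.inl s)
        by_cases hrs : r = s
        · subst hrs
          exact mul_eq_zero_of_right _ (hI _)
        · have h2 : glue M' v b' B' (Sum.inl r) (Sum.inl s) = M r s := by
            have : ¬(v = r ∧ v = s) := fun h => hrs (h.1.symm.trans h.2)
            simp [glue, hd, this]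
          rw [h2] at h1
          exact h1
      · by_cases hr : r = v
        · simp [Y, hr, hTv0]
        · simp [glue, hr]
      · by_cases hs : s = v
        · simp [Y, hs, hTv0]
        · simp [glue, hs]
      · simp [Y]
    · rintro (r | p)
      · exact hI _
      · rfl
    · intro a ha y
      obtain ⟨k, x, e⟩ := hcol y
      rw [e, mulVec_smul, Pi.smul_apply]
      obtain a | p := a
      · rw [← h.mulVec_extend_inl (hTv _), ← hT, hrow _ fun h => ha (congrArg _ (Sum.inl_injective h)),
          smul_zero]
      · rw [h.mulVec_extend_inr (hTv _) p, smul_zero]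
  obtain ⟨p₀, hp₀⟩ := Function.ne_iff.1 hu
  have hT0 : ∀ r, T (Sum.inl r) = 0 := fun r =>
    (mul_eq_zero.1 (congrFun (congrFun hY (Sum.inl r)) (Sum.inr p₀))).resolve_right hp₀
  ext (r | p) (s | q)
  · exact congrFun (congrFun hY (Sum.inl r)) (Sum.inl s)
  · rw [hXr, hT0, zero_mul]; rfl
  · rw [hXp, hT0, zero_mul]; rfl
  · exact hPP p q

end Glue

/-! ### Realizing the parameters -/

section Construct

variable {P : Type*} [Fintype P] [DecidableEq P]

theorem exists_posDef_mem_matricesOf (Γ : SimpleGraph P) : ∃ B ∈ matricesOf Γ, B.PosDef := by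
  classical
  refine ⟨Γ.lapMatrix ℝ + 1, ⟨(Γ.isSymm_lapMatrix (R := ℝ)).add isSymm_one, fun a b hab => ?_⟩,
    PosDef.posSemidef_add (Γ.posSemidef_lapMatrix ℝ) PosDef.one⟩
  simp [SimpleGraph.lapMatrix, SimpleGraph.degMatrix, SimpleGraph.adjMatrix_apply,
    diagonal_apply_ne _ hab, one_apply_ne hab]

/-- Any prescribed parameters `c` and `β ≠ 0` are realized by a matrix of a given graph. -/
theorem exists_kernelLine (Γ : SimpleGraph P) {b : P → ℝ} (hb : b ≠ 0) (c : ℝ) {β : ℝ}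
    (hβ : β ≠ 0) : ∃ B ∈ matricesOf Γ, ∃ u : P → ℝ, KernelLine B b u c ∧
      (∃ p, u p ≠ 0 ∧ b p ≠ 0) ∧ (c = 0 → b ⬝ᵥ u = β) := by
  obtain ⟨B, hB, hpos⟩ := exists_posDef_mem_matricesOf Γ
  have hdet : B.det ≠ 0 := hpos.det_pos.ne'
  have hunit : IsUnit B.det := isUnit_iff_ne_zero.2 hdet
  have hinv : 0 < b ⬝ᵥ (B⁻¹ *ᵥ b) := by simpa using hpos.inv.dotProduct_mulVec_pos hb
  -- Positivity of `b ⬝ᵥ B⁻¹ b` provides an index at which both `b` and `B⁻¹ b` are nonzero.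
  obtain ⟨j, -, hj⟩ := Finset.exists_ne_zero_of_sum_ne_zero hinv.ne'
  have hbj : b j ≠ 0 := left_ne_zero_of_mul hj
  have huj : (B⁻¹ *ᵥ b) j ≠ 0 := right_ne_zero_of_mul hj
  by_cases hc : c = 0
  swap
  · exact ⟨B, hB, _, kernelLine_of_det_ne_zero hdet b hc, ⟨j, mul_ne_zero hc huj, hbj⟩,
      fun h => absurd h hc⟩
  subst hc
  -- For `c = 0` a singular block is needed. Since `B x` is the `j`-th unit vector, subtracting `1 /
  -- x j` from the `j`-th diagonal entry makes `x` span the kernel; and `b ⬝ᵥ x = (B⁻¹ b) j` is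
  -- nonzero.
  set x : P → ℝ := B⁻¹ *ᵥ Pi.single j 1 with hx
  have hBx : B *ᵥ x = Pi.single j 1 := by
    rw [hx, mulVec_mulVec, mul_nonsing_inv _ hunit, one_mulVec]
  have hxj : x j ≠ 0 := by
    have : 0 < (Pi.single j 1 : P → ℝ) ⬝ᵥ x := by
      have := hpos.inv.dotProduct_mulVec_pos (x := Pi.single j (1 : ℝ)) (by simp)
      rwa [star_trivial] at this
    rw [single_one_dotProduct] at this
    exact this.ne'
  have hbx : b ⬝ᵥ x ≠ 0 := by
    have hsymm : B⁻¹ᵀ = B⁻¹ := by rw [transpose_nonsing_inv, hB.1.eq]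
    rw [hx, dotProduct_mulVec, ← mulVec_transpose, hsymm, dotProduct_single_one]
    exact huj
  have hmul : ∀ z, (B + Matrix.single j j (-(x j)⁻¹)) *ᵥ z =
      B *ᵥ (z - (z j / x j) • x) := fun z => by
    rw [add_mulVec, single_mulVec_eq, mulVec_sub, mulVec_smul, hBx, sub_eq_add_neg, ← neg_smul]
    congr 2
    ring
  have hBmem := add_single_mem_matricesOf hB j (-(x j)⁻¹)
  refine ⟨_, hBmem, (β / (b ⬝ᵥ x)) • x, kernelLine_of_kernel hBmem.1 ?_ hbx ?_
    (div_ne_zero hβ hbx), ⟨j, mul_ne_zero (div_ne_zero hβ hbx) hxj, hbj⟩, fun _ => ?_⟩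
  · rw [hmul, div_self hxj, one_smul, sub_self, mulVec_zero]
  · intro z hz
    rw [hmul] at hz
    exact ⟨_, sub_eq_zero.1 (eq_zero_of_mulVec_eq_zero hdet hz)⟩
  · rw [dotProduct_smul, smul_eq_mul, div_mul_cancel₀ _ hbx]

/-- If no nonzero kernel vector of `B` is orthogonal to `b`, then `B` has nullity at most one and
is described by one parameter. -/
theorem exists_kernelLine_of_trivial {B : Matrix P P ℝ} (hB : B.IsSymm) {b : P → ℝ} (hb : b ≠ 0)
    (h : ∀ x, B *ᵥ x = 0 → b ⬝ᵥ x = 0 → x = 0) :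
    ∃ (u : P → ℝ) (c : ℝ), KernelLine B b u c ∧ u ≠ 0 ∧ (c = 0 → b ⬝ᵥ u = 1) := by
  by_cases hdet : B.det = 0
  · obtain ⟨x, hx0, hx⟩ := exists_mulVec_eq_zero_iff.2 hdet
    have hbx : b ⬝ᵥ x ≠ 0 := fun hbx => hx0 (h x hx hbx)
    refine ⟨(b ⬝ᵥ x)⁻¹ • x, 0, kernelLine_of_kernel hB hx hbx (fun z hz => ?_)
      (inv_ne_zero hbx), smul_ne_zero (inv_ne_zero hbx) hx0, fun _ => ?_⟩
    -- Subtracting this multiple of `x` makes the kernel vector `z` orthogonal to `b`, hence zero.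
    · refine ⟨b ⬝ᵥ z / b ⬝ᵥ x, sub_eq_zero.1 (h _ ?_ ?_)⟩
      · rw [mulVec_sub, mulVec_smul, hz, hx, smul_zero, sub_zero]
      · rw [dotProduct_sub, dotProduct_smul, smul_eq_mul, div_mul_cancel₀ _ hbx, sub_self]
    · rw [dotProduct_smul, smul_eq_mul, inv_mul_cancel₀ hbx]
  · refine ⟨_, 1, kernelLine_of_det_ne_zero hdet b one_ne_zero, fun hu => hb ?_,
      fun h => absurd h one_ne_zero⟩
    have hunit : IsUnit B.det := isUnit_iff_ne_zero.2 hdet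
    rw [one_smul] at hu
    rw [← one_mulVec b, ← mul_nonsing_inv _ hunit, ← mulVec_mulVec, hu, mulVec_zero]

end Construct

/-! ### Replacing a summand by an edge and conversely -/

section VertexSum

variable {R W : Type*} [Fintype R] [DecidableEq R] [Fintype W] [DecidableEq W]

/-- Supplies the diagonal correction at `v`; a mismatch of `β` is an obstruction only when `c = 0`.
-/
theorem exists_diag {c β β' : ℝ} (h : c = 0 → β = β') : ∃ d : ℝ, β + d * c = β' := by
  by_cases hc : c = 0
  · exact ⟨0, by rw [h hc]; ring⟩
  · exact ⟨(β' - β) / c, by field_simp; ring⟩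

/-- The vertices of `K₂` other than `0`. -/
abbrev uniqueFinTwoNeZero : Unique {x : Fin 2 // x ≠ 0} where
  default := ⟨1, by decide⟩
  uniq := by decide

theorem AllowsWithSNIP.of_vertexSum_top {H : SimpleGraph R} {v i : R} {K : SimpleGraph W} {w : W}
    (hK : ∃ p, K.Adj w p) {k l : ℕ}
    (h : AllowsWithSNIP (vertexSum H v (⊤ : SimpleGraph (Fin 2)) 0) (Sum.inl i) k l) :
    AllowsWithSNIP (vertexSum H v K w) (Sum.inl i) k l := by
  classical
  let := uniqueFinTwoNeZero
  obtain ⟨A, hA, rfl, rfl, hS⟩ := h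
  obtain ⟨M, b, B, hM, hb, hB, rfl⟩ := exists_eq_glue hA
  have hβ : b default ≠ 0 := (hb default).2 (by simpa using (default : {x : Fin 2 // x ≠ 0}).2.symm)
  set β := b default
  set c := B default default / β with hc
  have hb' : b = fun _ => β := funext fun p => by rw [Subsingleton.elim p default]
  have hB' : B = Matrix.of fun _ _ => β * c := by
    ext p q
    rw [Subsingleton.elim p default, Subsingleton.elim q default, of_apply, hc,
      mul_div_cancel₀ _ hβ]
  have hline : KernelLine B b (fun _ => 1) c := by
    rw [hB', hb']
    exact kernelLine_of_unique hβ c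
  let b₁ : {x // x ≠ w} → ℝ := fun p => if K.Adj w p then 1 else 0
  have hb₁ : b₁ ≠ 0 := by
    obtain ⟨p, hp⟩ := hK
    exact Function.ne_iff.2 ⟨⟨p, hp.ne'⟩, by simp [b₁, hp]⟩
  obtain ⟨B₁, hB₁, u, hu, ⟨p, hup, hbp⟩, hu0⟩ := exists_kernelLine (K.comap Subtype.val) hb₁ c hβ
  obtain ⟨d, hd⟩ := exists_diag (c := c) (β := b ⬝ᵥ fun _ => 1) (β' := b₁ ⬝ᵥ u) (fun h => by
    rw [hu0 h]; simp [hb', dotProduct])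
  have hex : Exchange M (M + Matrix.single v v d) v b (fun _ => 1) B b₁ u B₁ c :=
    ⟨hline, hu, d, rfl, hd⟩
  have h1 : (fun _ : {x : Fin 2 // x ≠ 0} => (1 : ℝ)) ≠ 0 :=
    Function.ne_iff.2 ⟨default, one_ne_zero⟩
  have hu1 : u ≠ 0 := Function.ne_iff.2 ⟨p, hup⟩
  exact ⟨_, glue_mem_matricesOf (add_single_mem_matricesOf hM v d) (fun p => by simp [b₁]) hB₁,
    hex.nullity_eq h1 hu1, hex.nullity_deleteIndex_eq h1 hu1 i, hex.hasSNIP h1 hup hbp hS⟩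

theorem allowsWithSNIP_vertexSum_top {H : SimpleGraph R} {v i : R} {K : SimpleGraph W} {w : W}
    (hK : ∃ p, K.Adj w p) {A : Matrix (R ⊕ {x // x ≠ w}) (R ⊕ {x // x ≠ w}) ℝ}
    (hA : A ∈ matricesOf (vertexSum H v K w)) (hS : HasSNIP A (Sum.inl i))
    (hker : ∀ ξ, A *ᵥ ξ = 0 → (∀ r, ξ (Sum.inl r) = 0) → ξ = 0) :
    AllowsWithSNIP (vertexSum H v (⊤ : SimpleGraph (Fin 2)) 0) (Sum.inl i)
      (nullity A) (nullity (deleteIndex A (Sum.inl i))) := by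
  let := uniqueFinTwoNeZero
  obtain ⟨M, b, B, hM, hb, hB, rfl⟩ := exists_eq_glue hA
  have hb0 : b ≠ 0 := by
    obtain ⟨p, hp⟩ := hK
    exact Function.ne_iff.2 ⟨⟨p, hp.ne'⟩, (hb _).2 hp⟩
  -- A kernel vector of `B` orthogonal to `b`, extended by zero, is a null vector of the glued
  -- matrix inside the piece.
  obtain ⟨u, c, hu, hu1, hu0⟩ := exists_kernelLine_of_trivial hB.1 hb0 (fun x hx hbx => by
    have := hker (Sum.elim 0 x) (by
      ext (r | p)
      · rw [glue_mulVec_inl, Sum.elim_comp_inl, Sum.elim_comp_inr, hbx]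
        simp
      · rw [glue_mulVec_inr, Sum.elim_comp_inr, hx]
        simp) (fun r => rfl)
    exact funext fun p => congrFun this (Sum.inr p))
  obtain ⟨d, hd⟩ := exists_diag (c := c) (β := b ⬝ᵥ u)
    (β' := (fun _ => 1) ⬝ᵥ fun _ : {x : Fin 2 // x ≠ 0} => (1 : ℝ)) (fun h => by
    rw [hu0 h]; simp [dotProduct])
  have hex : Exchange M (M + Matrix.single v v d) v b u B (fun _ => 1) (fun _ => 1)
      (Matrix.of fun _ _ : {x : Fin 2 // x ≠ 0} => 1 * c) c :=
    ⟨hu, kernelLine_of_unique one_ne_zero c, d, rfl, hd⟩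
  have h1 : (fun _ : {x : Fin 2 // x ≠ 0} => (1 : ℝ)) ≠ 0 :=
    Function.ne_iff.2 ⟨default, one_ne_zero⟩
  refine ⟨_, glue_mem_matricesOf (add_single_mem_matricesOf hM v d) (fun p => ?_)
    ⟨IsSymm.ext fun _ _ => rfl, fun p q hpq => absurd (Subsingleton.elim p q) hpq⟩,
    hex.nullity_eq hu1 h1, hex.nullity_deleteIndex_eq hu1 h1 i,
    hex.hasSNIP (p₁ := default) hu1 one_ne_zero one_ne_zero hS⟩
  simpa using p.2.symm

/-- The equivalence exchanging the last two of three summands. -/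
def sumRightComm (α β γ : Type*) : (α ⊕ β) ⊕ γ ≃ (α ⊕ γ) ⊕ β where
  toFun := Sum.elim (Sum.map Sum.inl id) (Sum.inl ∘ Sum.inr)
  invFun := Sum.elim (Sum.map Sum.inl id) (Sum.inl ∘ Sum.inr)
  left_inv := by rintro ((a | b) | c) <;> rfl
  right_inv := by rintro ((a | b) | c) <;> rfl

/-- Two vertex sums may be performed in either order. -/
def vertexSumComm {V W₁ W₂ : Type*} (G₀ : SimpleGraph V) (v₁ v₂ : V) (G₁ : SimpleGraph W₁)
    (w₁ : W₁) (G₂ : SimpleGraph W₂) (w₂ : W₂) :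
    vertexSum (vertexSum G₀ v₁ G₁ w₁) (Sum.inl v₂) G₂ w₂ ≃g
      vertexSum (vertexSum G₀ v₂ G₂ w₂) (Sum.inl v₁) G₁ w₁ where
  toEquiv := sumRightComm _ _ _
  map_rel_iff' := by
    rintro ((a | x) | y) ((b | x') | y') <;> simp [vertexSum, sumRightComm]

theorem xixi_le_of_allows {V V' : Type*} [Fintype V] [DecidableEq V] [Fintype V'] [DecidableEq V']
    {G : SimpleGraph V} {H : SimpleGraph V'} {i : V} {j : V'}
    (h : ∀ k l, AllowsWithSNIP G i k l → AllowsWithSNIP H j k l) : xixi G i ≤ xixi H j := by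
  obtain ⟨k, l, hkl, hA, hs⟩ := (isGreatest_xixi G i).1
  exact (isGreatest_xixi H j).2 ⟨k, l, hkl, h k l hA, hs⟩

variable {W' : Type*} [Fintype W'] [DecidableEq W']

/-- A matrix with the `i`-SNIP for a graph with two pendant pieces allows one of the pieces to be
replaced by an edge. -/
theorem AllowsWithSNIP.vertexSum_top_or {G₀ : SimpleGraph R} {v₁ v₂ i : R} {G₁ : SimpleGraph W}
    {w₁ : W} {G₂ : SimpleGraph W'} {w₂ : W'} (hG₁ : ∃ p, G₁.Adj w₁ p) (hG₂ : ∃ p, G₂.Adj w₂ p)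
    {k l : ℕ}
    (h : AllowsWithSNIP (vertexSum (vertexSum G₀ v₁ G₁ w₁) (Sum.inl v₂) G₂ w₂)
      (Sum.inl (Sum.inl i)) k l) :
    AllowsWithSNIP (vertexSum (vertexSum G₀ v₁ (⊤ : SimpleGraph (Fin 2)) 0) (Sum.inl v₂) G₂ w₂)
        (Sum.inl (Sum.inl i)) k l ∨
      AllowsWithSNIP (vertexSum (vertexSum G₀ v₁ G₁ w₁) (Sum.inl v₂) (⊤ : SimpleGraph (Fin 2)) 0)
        (Sum.inl (Sum.inl i)) k l := by
  obtain ⟨A, hA, rfl, rfl, hS⟩ := h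
  by_cases h2 : ∀ η, A *ᵥ η = 0 → (∀ r, η (Sum.inl r) = 0) → η = 0
  · exact Or.inr (allowsWithSNIP_vertexSum_top hG₂ hA hS h2)
  left
  push Not at h2
  obtain ⟨η, hη, hηl, hη0⟩ := h2
  have h1 : ∀ ξ, A *ᵥ ξ = 0 → (∀ a, ξ (Sum.inl (Sum.inl a)) = 0) → (∀ q, ξ (Sum.inr q) = 0) →
      ξ = 0 := by
    intro ξ hξ hξ0 hξ2
    refine (hS.eq_zero_or_eq_zero hA.1 hξ hη ?_).resolve_right hη0
    -- Here `ξ` lives on `G₁` without `w₁` and `η` on `G₂` without `w₂`; no edge joins these sets,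
    -- even if `v₁ = v₂`.
    rintro ((a | p) | q) (r | q') hne hne'
    · exact absurd (hξ0 a) hne
    · exact absurd (hξ0 a) hne
    · exact absurd (hηl r) hne'
    · refine ⟨Sum.inl_ne_inr, ?_⟩
      by_contra hpq
      have := (hA.2 _ _ Sum.inl_ne_inr).1 hpq
      simp [vertexSum] at this
    · exact absurd (hξ2 q) hne
    · exact absurd (hξ2 q) hne
  -- The exchange acts on the outermost summand, so the order of the two sums is reversed.
  let e := vertexSumComm G₀ v₂ v₁ G₂ w₂ G₁ w₁
  have hA' : A.submatrix e e ∈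
      matricesOf (vertexSum (vertexSum G₀ v₂ G₂ w₂) (Sum.inl v₁) G₁ w₁) :=
    ⟨hA.1.submatrix _, fun a b hab =>
      (hA.2 (e a) (e b) (e.injective.ne hab)).trans e.map_rel_iff⟩
  have hS' : HasSNIP (A.submatrix e e) (Sum.inl (Sum.inl i)) := hS.submatrix e.toEquiv
  have := allowsWithSNIP_vertexSum_top hG₁ hA' hS' (fun ξ hξ hξ0 => by
    have h3 := h1 (ξ ∘ e.symm) (by
      rw [show A.submatrix e e *ᵥ ξ = (A *ᵥ (ξ ∘ e.symm)) ∘ e from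
        Matrix.submatrix_mulVec_equiv A ξ e e.toEquiv] at hξ
      ext a
      simpa using congrFun hξ (e.symm a)) (fun a => hξ0 _) (fun q => hξ0 _)
    ext a
    simpa using congrFun h3 (e a))
  have hn := nullity_submatrix A e.toEquiv
  have hd := nullity_deleteIndex_submatrix A e.toEquiv (Sum.inl (Sum.inl i))
  refine .of_iso (vertexSumComm G₀ v₁ v₂ ⊤ 0 G₂ w₂) ?_
  rw [← hn]
  exact hd ▸ this

end VertexSum

end RootedGraph

theorem mainTheorem9 {V₀ V₁ V₂ : Type*}
    [Fintype V₀] [DecidableEq V₀] [Fintype V₁] [DecidableEq V₁] [Fintype V₂] [DecidableEq V₂]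
    (G₀ : SimpleGraph V₀) (G₁ : SimpleGraph V₁) (G₂ : SimpleGraph V₂)
    (v₁ v₂ : V₀) (w₁ : V₁) (w₂ : V₂)
    (hG₁ : G₁.Connected) (hV₁ : 2 ≤ Fintype.card V₁)
    (hG₂ : G₂.Connected) (hV₂ : 2 ≤ Fintype.card V₂)
    (i : V₀) :
    RootedGraph.xixi
        (RootedGraph.vertexSum (RootedGraph.vertexSum G₀ v₁ G₁ w₁) (Sum.inl v₂) G₂ w₂)
        (Sum.inl (Sum.inl i)) =
      max
        (RootedGraph.xixi
          (RootedGraph.vertexSum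
            (RootedGraph.vertexSum G₀ v₁ (⊤ : SimpleGraph (Fin 2)) 0) (Sum.inl v₂) G₂ w₂)
          (Sum.inl (Sum.inl i)))
        (RootedGraph.xixi
          (RootedGraph.vertexSum
            (RootedGraph.vertexSum G₀ v₁ G₁ w₁) (Sum.inl v₂) (⊤ : SimpleGraph (Fin 2)) 0)
          (Sum.inl (Sum.inl i))) := by
  have : Nontrivial V₁ := Fintype.one_lt_card_iff_nontrivial.1 hV₁
  have : Nontrivial V₂ := Fintype.one_lt_card_iff_nontrivial.1 hV₂
  -- A neighbour of the shared vertex makes the coupling vector `b` of the piece nonzero.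
  have h₁ := hG₁.preconnected.exists_adj_of_nontrivial w₁
  have h₂ := hG₂.preconnected.exists_adj_of_nontrivial w₂
  refine le_antisymm ?_ (max_le ?_ ?_)
  · obtain ⟨k, l, hkl, hA, hs⟩ := (RootedGraph.isGreatest_xixi
      (RootedGraph.vertexSum (RootedGraph.vertexSum G₀ v₁ G₁ w₁) (Sum.inl v₂) G₂ w₂)
      (Sum.inl (Sum.inl i))).1
    rw [hs, le_max_iff]
    exact (hA.vertexSum_top_or h₁ h₂).imp
      (fun h => (RootedGraph.isGreatest_xixi _ _).2 ⟨k, l, hkl, h, rfl⟩)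
      (fun h => (RootedGraph.isGreatest_xixi _ _).2 ⟨k, l, hkl, h, rfl⟩)
  · refine RootedGraph.xixi_le_of_allows fun k l h => ?_
    refine RootedGraph.AllowsWithSNIP.of_iso
      (RootedGraph.vertexSumComm G₀ v₁ v₂ G₁ w₁ G₂ w₂) (.of_vertexSum_top h₁ ?_)
    exact RootedGraph.AllowsWithSNIP.of_iso
      (RootedGraph.vertexSumComm G₀ v₂ v₁ G₂ w₂ (⊤ : SimpleGraph (Fin 2)) 0) h
  · exact RootedGraph.xixi_le_of_allows fun k l h =>
      RootedGraph.AllowsWithSNIP.of_vertexSum_top h₂ h
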